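/- Let $L$ be a countable first-order signature. Let $\mathrm{Mod}(L)$ be the space of all (classical) $L$-structures with universe $\mathbb N$, and for $M\in\mathrm{Mod}(L)$ let $[M]=\{N\in\mathrm{Mod}(L): N\cong M\}$. Let $F$ be a fragment of $L_{\omega_1\omega}$, i.e. a countable set of $L_{\omega_1\omega}$-formulas that contains all atomic formulas and is closed under finitary connectives, quantifiers, subformulas, and substitution of terms for variables. Let $t_F$ be the topology on $\mathrm{Mod}(L)$ generated by the sets $\{M : M\models\phi(\bar a)\}$, where $\phi\in F$ and $\bar a\in\mathbb N^{<\mathbb N}$. For $M\in\mathrm{Mod}(L)$ and $\bar a\in\mathbb N^{<\mathbb N}$ of length $n$, let $\mathrm{tp}^0_M(\bar a)$ be the $F$-type of $\bar a$ in $M$, i.e. the set of all formulas $\phi(x_1,\dots,x_n)\in F$ with $M\models\phi(\bar a)$ (recorded together with $n$), and for ordinals $\alpha>0$ let $$\mathrm{tp}^\alpha_M(\bar a)=\{\mathrm{tp}^\beta_M(\bar b):\ \beta<\alpha,\ \bar b\in\mathbb N^{<\mathbb N},\ \bar a\subseteq\bar b\},$$ where $\bar a\subseteq\bar b$ means that $\bar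 b$ extends $\bar a$ as a sequence, and $F$-types are treated as atoms (not as sets) in forming these families. Put $\mathrm{Th}^\alpha_F(M)=\mathrm{tp}^\alpha_M(\emptyset)$. Let $1\le\alpha<\omega_1$ and let $M\in\mathrm{Mod}(L)$ be such that $[M]\in\mathbf\Pi^0_{1+\alpha}(t_F)$, where $\mathbf\Pi^0_{\xi}(t_F)$ is the $\xi$-th multiplicative Borel class with respect to $t_F$ ($\mathbf\Pi^0_1$ = closed sets). Then $$[M]=\{N\in\mathrm{Mod}(L):\ \mathrm{Th}^\alpha_F(N)=\mathrm{Th}^\alpha_F(M)\}.$$ -/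

import Mathlib

universe u v w

noncomputable section

namespace InfLogic

/-! Infinitary formulas -/

/-- Formulas of the infinitary logic `L_{ω₁ω}` in the signature `L` whose free variables are among
`x_0, …, x_{n-1}`. The variable bound by a quantifier in front of `φ : Fml L (n + 1)` is the
last one, `x_n`. -/
inductive Fml (L : FirstOrder.Language.{u, v}) : ℕ → Type (max u v)
  | verum {n : ℕ} : Fml L n
  | equal {n : ℕ} (s t : L.Term (Fin n)) : Fml L n
  | rel {n k : ℕ} (R : L.Relations k) (ts : Fin k → L.Term (Fin n)) : Fml L n
  | neg {n : ℕ} (φ : Fml L n) : Fml L n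
  | and {n : ℕ} (φ ψ : Fml L n) : Fml L n
  | or {n : ℕ} (φ ψ : Fml L n) : Fml L n
  | all {n : ℕ} (φ : Fml L (n + 1)) : Fml L n
  | ex {n : ℕ} (φ : Fml L (n + 1)) : Fml L n
  | iAnd {n : ℕ} (φ : ℕ → Fml L n) : Fml L n
  | iOr {n : ℕ} (φ : ℕ → Fml L n) : Fml L n

namespace Fml

variable {L : FirstOrder.Language.{u, v}}

/-- A substitution extended to one more variable, which is left fixed. -/
def liftSubst {n m : ℕ} (σ : Fin n → L.Term (Fin m)) : Fin (n + 1) → L.Term (Fin (m + 1)) :=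
  Fin.snoc (α := fun _ => L.Term (Fin (m + 1)))
    (fun i => (σ i).relabel Fin.castSucc) (FirstOrder.Language.Term.var (Fin.last m))

/-- Capture-avoiding simultaneous substitution of the terms `σ i` for the variables `x_i`. -/
def subst : {n m : ℕ} → Fml L n → (Fin n → L.Term (Fin m)) → Fml L m
  | _, _, verum, _ => verum
  | _, _, equal s t, σ => equal (s.subst σ) (t.subst σ)
  | _, _, rel R ts, σ => rel R (fun i => (ts i).subst σ)
  | _, _, neg φ, σ => neg (φ.subst σ)
  | _, _, and φ ψ, σ => and (φ.subst σ) (ψ.subst σ)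
  | _, _, or φ ψ, σ => or (φ.subst σ) (ψ.subst σ)
  | _, _, all φ, σ => all (φ.subst (liftSubst σ))
  | _, _, ex φ, σ => ex (φ.subst (liftSubst σ))
  | _, _, iAnd φ, σ => iAnd (fun i => (φ i).subst σ)
  | _, _, iOr φ, σ => iOr (fun i => (φ i).subst σ)

/-- Satisfaction of a formula by a tuple `a` of elements of a structure `X`. -/
def Realize {X : Type w} [L.Structure X] : {n : ℕ} → Fml L n → (Fin n → X) → Prop
  | _, verum, _ => True
  | _, equal s t, a => s.realize a = t.realize a
  | _, rel R ts, a => FirstOrder.Language.Structure.RelMap R (fun i => (ts i).realize a)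
  | _, neg φ, a => ¬ φ.Realize a
  | _, and φ ψ, a => φ.Realize a ∧ ψ.Realize a
  | _, or φ ψ, a => φ.Realize a ∨ ψ.Realize a
  | _, all φ, a => ∀ x : X, φ.Realize (Fin.snoc (α := fun _ => X) a x)
  | _, ex φ, a => ∃ x : X, φ.Realize (Fin.snoc (α := fun _ => X) a x)
  | _, iAnd φ, a => ∀ i, (φ i).Realize a
  | _, iOr φ, a => ∃ i, (φ i).Realize a

end Fml

/-- A fragment of `L_{ω₁ω}`: a countable set of formulas that contains all atomic formulas and is
closed under the finitary connectives, quantifiers, subformulas, and substitution of terms for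
variables. `F.mem n` is the set of formulas of `F` with free variables among `x_0, …, x_{n-1}`. -/
structure Fragment (L : FirstOrder.Language.{u, v}) where
  mem : (n : ℕ) → Set (Fml L n)
  countable : ∀ n, (mem n).Countable
  verum_mem : ∀ n, Fml.verum ∈ mem n
  equal_mem : ∀ {n} (s t : L.Term (Fin n)), Fml.equal s t ∈ mem n
  rel_mem : ∀ {n k} (R : L.Relations k) (ts : Fin k → L.Term (Fin n)), Fml.rel R ts ∈ mem n
  neg_mem_iff : ∀ {n} (φ : Fml L n), φ.neg ∈ mem n ↔ φ ∈ mem n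
  and_mem_iff : ∀ {n} (φ ψ : Fml L n), φ.and ψ ∈ mem n ↔ φ ∈ mem n ∧ ψ ∈ mem n
  or_mem_iff : ∀ {n} (φ ψ : Fml L n), φ.or ψ ∈ mem n ↔ φ ∈ mem n ∧ ψ ∈ mem n
  all_mem_iff : ∀ {n} (φ : Fml L (n + 1)), φ.all ∈ mem n ↔ φ ∈ mem (n + 1)
  ex_mem_iff : ∀ {n} (φ : Fml L (n + 1)), φ.ex ∈ mem n ↔ φ ∈ mem (n + 1)
  of_iAnd_mem : ∀ {n} (φ : ℕ → Fml L n), Fml.iAnd φ ∈ mem n → ∀ i, φ i ∈ mem n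
  of_iOr_mem : ∀ {n} (φ : ℕ → Fml L n), Fml.iOr φ ∈ mem n → ∀ i, φ i ∈ mem n
  subst_mem : ∀ {n m} (φ : Fml L n) (σ : Fin n → L.Term (Fin m)), φ ∈ mem n → φ.subst σ ∈ mem m

/-! The space of countable structures -/

/-- The space of all `L`-structures with universe `ℕ`. -/
abbrev Mod (L : FirstOrder.Language.{u, v}) : Type (max u v) := L.Structure ℕ

/-- `M ⊨ φ(a)`, for a structure `M` with universe `ℕ`. -/
def Sat {L : FirstOrder.Language.{u, v}} (M : Mod L) {n : ℕ} (φ : Fml L n) (a : Fin n → ℕ) : Prop :=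
  @Fml.Realize L ℕ M n φ a

/-- The isomorphism class `[M]` of `M` in `Mod L`. -/
def isoClass {L : FirstOrder.Language.{u, v}} (M : Mod L) : Set (Mod L) :=
  {N | Nonempty (@FirstOrder.Language.Equiv L ℕ ℕ M N)}

/-- The topology `t_F` on `Mod L`, generated by the sets `{M | M ⊨ φ(a)}` with `φ ∈ F` and `a` a
finite tuple of natural numbers. -/
abbrev fragmentTopology {L : FirstOrder.Language.{u, v}} (F : Fragment L) : TopologicalSpace (Mod L) :=
  TopologicalSpace.generateFrom
    {U | ∃ (n : ℕ) (φ : Fml L n) (a : Fin n → ℕ), φ ∈ F.mem n ∧ U = {M : Mod L | Sat M φ a}}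

/-! The Borel hierarchy -/

/-- The additive classes `Σ⁰_ξ`, `1 ≤ ξ`: the class `Σ⁰_1` consists of the open sets, and for `ξ > 1`
the class `Σ⁰_ξ` consists of the countable unions of complements of sets from earlier classes. -/
inductive SigmaZero {X : Type w} (t : TopologicalSpace X) : Ordinal.{0} → Set X → Prop
  | of_isOpen (U : Set X) (hU : @IsOpen X t U) : SigmaZero t 1 U
  | iUnion_compl (ξ : Ordinal.{0}) (hξ : 1 < ξ) (η : ℕ → Ordinal.{0}) (hη : ∀ n, η n < ξ)
      (A : ℕ → Set X) (hA : ∀ n, SigmaZero t (η n) (A n)) : SigmaZero t ξ (⋃ n, (A n)ᶜ)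

/-- The multiplicative classes `Π⁰_ξ`, `1 ≤ ξ`. -/
def PiZero {X : Type w} (t : TopologicalSpace X) (ξ : Ordinal.{0}) (A : Set X) : Prop :=
  SigmaZero t ξ Aᶜ

/-! Iterated families over a set of atoms -/

/-- Presentations of hereditary sets over atoms from `A`: an atom, or an indexed family of
presentations, standing for the set of its members. -/
inductive PreHSet (A : Type u) : Type (max u (v + 1))
  | atom (a : A) : PreHSet A
  | family (ι : Type v) (f : ι → PreHSet A) : PreHSet A

namespace PreHSet

/-- Two presentations denote the same object: equal atoms, or families with the same members. -/
def Equiv {A : Type u} : PreHSet.{u, v} A → PreHSet.{u, v} A → Prop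
  | atom a, atom b => a = b
  | family _ f, family _ g =>
      (∀ i, ∃ j, Equiv (f i) (g j)) ∧ (∀ j, ∃ i, Equiv (f i) (g j))
  | atom _, family _ _ => False
  | family _ _, atom _ => False

theorem Equiv.refl {A : Type u} (x : PreHSet.{u, v} A) : Equiv x x := by
  induction x with
  | atom a => rfl
  | family ι f ih => exact ⟨fun i => ⟨i, ih i⟩, fun i => ⟨i, ih i⟩⟩

theorem Equiv.symm {A : Type u} {x y : PreHSet.{u, v} A} (h : Equiv x y) : Equiv y x := by
  induction x generalizing y with
  | atom a =>
    cases y with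
    | atom b => exact Eq.symm h
    | family κ g => exact h.elim
  | family ι f ih =>
    cases y with
    | atom b => exact h.elim
    | family κ g =>
      refine ⟨fun j => ?_, fun i => ?_⟩
      · obtain ⟨i, hi⟩ := h.2 j
        exact ⟨i, ih i hi⟩
      · obtain ⟨j, hj⟩ := h.1 i
        exact ⟨j, ih i hj⟩

theorem Equiv.trans {A : Type u} {x y z : PreHSet.{u, v} A} (h : Equiv x y) (h' : Equiv y z) :
    Equiv x z := by
  induction x generalizing y z with
  | atom a =>
    cases y with
    | atom b =>
      cases z with
      | atom c => exact Eq.trans h h'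
      | family μ k => exact h'.elim
    | family κ g => exact h.elim
  | family ι f ih =>
    cases y with
    | atom b => exact h.elim
    | family κ g =>
      cases z with
      | atom c => exact h'.elim
      | family μ k =>
        refine ⟨fun i => ?_, fun l => ?_⟩
        · obtain ⟨j, hj⟩ := h.1 i
          obtain ⟨l, hl⟩ := h'.1 j
          exact ⟨l, ih i hj hl⟩
        · obtain ⟨j, hj⟩ := h'.2 l
          obtain ⟨i, hi⟩ := h.2 j
          exact ⟨i, ih i hi hj⟩

instance setoid (A : Type u) : Setoid (PreHSet.{u, v} A) :=
  ⟨Equiv, Equiv.refl, Equiv.symm, Equiv.trans⟩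

end PreHSet

/-- Hereditary sets over atoms from `A`: every element is either an atom or a set of elements, and
sets are extensional. -/
def HSet (A : Type u) : Type (max u (v + 1)) := Quotient (PreHSet.setoid.{u, v} A)

namespace HSet

/-- An atom. -/
def atom {A : Type u} (a : A) : HSet.{u, v} A := Quotient.mk _ (PreHSet.atom a)

/-- The set `{f i : i ∈ ι}`. -/
def range {A : Type u} {ι : Type v} (f : ι → HSet.{u, v} A) : HSet.{u, v} A :=
  Quotient.mk _ (PreHSet.family ι (fun i => (f i).out))

theorem atom_inj {A : Type u} {a b : A} : (atom a : HSet.{u, v} A) = atom b ↔ a = b :=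
  Quotient.eq

theorem atom_ne_range {A : Type u} {ι : Type v} (a : A) (f : ι → HSet.{u, v} A) :
    atom a ≠ range f := fun h => (Quotient.eq.1 h : False)

theorem range_eq_range_iff {A : Type u} {ι κ : Type v} (f : ι → HSet.{u, v} A)
    (g : κ → HSet.{u, v} A) : range f = range g ↔ Set.range f = Set.range g := by
  have key : ∀ x y : HSet.{u, v} A, PreHSet.Equiv x.out y.out ↔ x = y :=
    fun x y =>
    Quotient.out_equiv_out (s := PreHSet.setoid.{u, v} A)
  have h1 : range f = range g ↔ (∀ i, ∃ j, PreHSet.Equiv (f i).out (g j).out) ∧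
      (∀ j, ∃ i, PreHSet.Equiv (f i).out (g j).out) := Quotient.eq
  rw [h1]
  simp only [key]
  constructor
  · rintro ⟨h, h'⟩
    ext x
    constructor
    · rintro ⟨i, rfl⟩
      obtain ⟨j, hj⟩ := h i
      exact ⟨j, hj.symm⟩
    · rintro ⟨j, rfl⟩
      exact h' j
  · intro h
    refine ⟨fun i => ?_, fun j => ?_⟩
    · obtain ⟨j, hj⟩ := h.subset ⟨i, rfl⟩
      exact ⟨j, hj.symm⟩
    · exact h.superset ⟨j, rfl⟩

end HSet

/-! Iterated types -/

/-- The `F`-type of a finite tuple `a` in `M`, recorded with its number of variables. -/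
def tp {L : FirstOrder.Language.{u, v}} (F : Fragment L) (M : Mod L) (a : List ℕ) :
    Σ n : ℕ, Set (Fml L n) :=
  ⟨a.length, {φ | φ ∈ F.mem a.length ∧ Sat M φ a.get}⟩

open Classical in
/-- The iterated types: `tp^0(a) = tp(a)`, and
`tp^α(a) = {tp^β(b) : β < α, b a finite tuple extending a}` for `α > 0`. -/
def iterTp {L : FirstOrder.Language.{u, v}} (F : Fragment L) (M : Mod L) (α : Ordinal.{0}) (a : List ℕ) :
    HSet.{max u v, 1} (Σ n : ℕ, Set (Fml L n)) :=
  if α = 0 then HSet.atom (tp F M a)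
  else HSet.range (fun p : Set.Iio α × {b : List ℕ // a <+: b} => iterTp F M p.1 p.2)
termination_by α
decreasing_by exact p.1.2

/-- `Th^α_F(M) = tp^α(∅)`. -/
def iterTh {L : FirstOrder.Language.{u, v}} (F : Fragment L) (α : Ordinal.{0}) (M : Mod L) :
    HSet.{max u v, 1} (Σ n : ℕ, Set (Fml L n)) :=
  iterTp F M α []

end InfLogic

end

/-! The proof uses Vaught transforms with forcing by finite injective sequences. For a set `A` of
structures in Σ⁰ of index 1 + α, let `P N b` say that the pullback of `N` along some sufficiently
generic permutation extending `b` lies in `A`. The point is that `P N b` depends only on the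
iterated type of `b` in `N` of rank α. This is proved by induction on the Borel class
(`SigmaZero.hasTransform`).

For open `A`, a neighbourhood is given by one formula of the fragment, so `P` is witnessed by
existential formulas true of `b` (`hasTransform_of_isOpen`). For a countable union of complements,
`P N b` says that some injective `c` extending `b` fails one of the earlier transforms. The rank-α
type of `b` lists the lower-rank types of all its extensions, so it settles this
(`hasTransform_iUnion_compl`).

Isomorphic structures have equal theories by `iterTp_map_perm`. Conversely, apply the transform to
the complement of `[M]`. If `N` is outside `[M]`, so are its pullbacks, hence `P` holds at the empty
sequence in `N`. Equality of theories moves it to `M`, and some pullback of `M` then lies outside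
`[M]`, which is absurd. -/

namespace InfLogic

variable {L : FirstOrder.Language.{u, v}}

/-! ### Satisfaction under substitution and isomorphism -/

namespace Fml

theorem realize_liftSubst {X : Type w} [L.Structure X] {n m : ℕ} (σ : Fin n → L.Term (Fin m))
    (a : Fin m → X) (x : X) :
    (fun i => (liftSubst σ i).realize (Fin.snoc (α := fun _ => X) a x)) =
      Fin.snoc (α := fun _ => X) (fun i => (σ i).realize a) x := by
  funext i
  refine Fin.lastCases ?_ (fun j => ?_) i
  · simp [liftSubst]
  · have : (Fin.snoc (α := fun _ => X) a x) ∘ Fin.castSucc = a := by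
      funext k
      simp
    simp [liftSubst, this]

theorem realize_subst {X : Type w} [L.Structure X] {n : ℕ} (φ : Fml L n) :
    ∀ {m : ℕ} (σ : Fin n → L.Term (Fin m)) (a : Fin m → X),
      (φ.subst σ).Realize a ↔ φ.Realize (fun i => (σ i).realize a) := by
  induction φ with
  | verum => intro m σ a; simp [subst, Realize]
  | equal s t => intro m σ a; simp [subst, Realize]
  | rel R ts => intro m σ a; simp [subst, Realize]
  | neg φ ih => intro m σ a; simp [subst, Realize, ih]
  | and φ ψ ih ih' => intro m σ a; simp [subst, Realize, ih, ih']
  | or φ ψ ih ih' => intro m σ a; simp [subst, Realize, ih, ih']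
  | all φ ih => intro m σ a; simp [subst, Realize, ih, realize_liftSubst]
  | ex φ ih => intro m σ a; simp [subst, Realize, ih, realize_liftSubst]
  | iAnd φ ih => intro m σ a; simp [subst, Realize, ih]
  | iOr φ ih => intro m σ a; simp [subst, Realize, ih]

theorem realize_comp_equiv {X Y : Type w} [L.Structure X] [L.Structure Y]
    (e : FirstOrder.Language.Equiv L X Y) {n : ℕ} (φ : Fml L n) :
    ∀ a : Fin n → X, φ.Realize (e ∘ a) ↔ φ.Realize a := by
  have hs : ∀ {n : ℕ} (a : Fin n → X) (x : X), Fin.snoc (α := fun _ => Y) (e ∘ a) (e x) =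
      e ∘ Fin.snoc (α := fun _ => X) a x := fun a x => (Fin.comp_snoc e a x).symm
  induction φ with
  | verum => intro a; simp [Realize]
  | equal s t =>
    intro a
    simp only [Realize, FirstOrder.Language.HomClass.realize_term]
    exact e.injective.eq_iff
  | rel R ts =>
    intro a
    simp only [Realize, FirstOrder.Language.HomClass.realize_term]
    exact e.map_rel R _
  | neg φ ih => intro a; simp [Realize, ih]
  | and φ ψ ih ih' => intro a; simp [Realize, ih, ih']
  | or φ ψ ih ih' => intro a; simp [Realize, ih, ih']
  | all φ ih =>
    intro a
    simp only [Realize, e.surjective.forall, hs, ih]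
  | ex φ ih =>
    intro a
    simp only [Realize, e.surjective.exists, hs, ih]
  | iAnd φ ih => intro a; simp [Realize, ih]
  | iOr φ ih => intro a; simp [Realize, ih]

end Fml

/-! ### Formulas available in a fragment -/

namespace Fragment

variable (F : Fragment L)

/-- Fragments are closed under finite conjunctions. -/
theorem exists_forall_sat {ι : Type} [Finite ι] {n : ℕ} (φ : ι → Fml L n)
    (hφ : ∀ i, φ i ∈ F.mem n) :
    ∃ ψ ∈ F.mem n, ∀ (M : Mod L) (a : Fin n → ℕ), Sat M ψ a ↔ ∀ i, Sat M (φ i) a := by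
  cases nonempty_fintype ι
  have key : ∀ s : Finset ι, ∃ ψ ∈ F.mem n, ∀ (M : Mod L) (a : Fin n → ℕ),
      Sat M ψ a ↔ ∀ i ∈ s, Sat M (φ i) a := by
    classical
    intro s
    induction s using Finset.induction_on with
    | empty => exact ⟨.verum, F.verum_mem n, fun M a => by simp [Sat, Fml.Realize]⟩
    | insert i s _ ih =>
      obtain ⟨ψ, hψ, h⟩ := ih
      refine ⟨.and (φ i) ψ, (F.and_mem_iff _ _).2 ⟨hφ i, hψ⟩, fun M a => ?_⟩
      rw [Finset.forall_mem_insert, ← h]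
      rfl
  obtain ⟨ψ, hψ, h⟩ := key Finset.univ
  exact ⟨ψ, hψ, fun M a => by simp [h]⟩

/-- Injective tuples are exactly those that extend to permutations, so the `F`-type must detect
injectivity. -/
theorem exists_sat_iff_injective (n : ℕ) :
    ∃ ψ ∈ F.mem n, ∀ (M : Mod L) (a : Fin n → ℕ), Sat M ψ a ↔ Function.Injective a := by
  obtain ⟨ψ, hψ, h⟩ := F.exists_forall_sat (ι := {p : Fin n × Fin n // p.1 ≠ p.2})
    (fun p => .neg (.equal (.var p.1.1) (.var p.1.2)))
    (fun p => (F.neg_mem_iff _).2 (F.equal_mem _ _))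
  refine ⟨ψ, hψ, fun M a => (h M a).trans ⟨fun H i j hij => ?_, fun H p hp => p.2 (H hp)⟩⟩
  by_contra hne
  exact H ⟨(i, j), hne⟩ hij

/-- Fragments are closed under finite strings of existential quantifiers. -/
theorem exists_sat_iff_exists {n m : ℕ} (hnm : n ≤ m) (ψ : Fml L m) (hψ : ψ ∈ F.mem m) :
    ∃ χ ∈ F.mem n, ∀ (M : Mod L) (a : Fin n → ℕ),
      Sat M χ a ↔ ∃ d : Fin m → ℕ, (∀ i, d (Fin.castLE hnm i) = a i) ∧ Sat M ψ d := by
  induction m, hnm using Nat.le_induction with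
  | base =>
    refine ⟨ψ, hψ, fun M a => ⟨fun h => ⟨a, fun i => rfl, h⟩, ?_⟩⟩
    rintro ⟨d, hd, h⟩
    obtain rfl : d = a := funext hd
    exact h
  | succ m hnm ih =>
    obtain ⟨χ, hχ, h⟩ := ih ψ.ex ((F.ex_mem_iff ψ).2 hψ)
    refine ⟨χ, hχ, fun M a => (h M a).trans ⟨?_, ?_⟩⟩
    · rintro ⟨d, hd, x, hx⟩
      refine ⟨Fin.snoc (α := fun _ => ℕ) d x, fun i => ?_, hx⟩
      rw [← hd i]
      exact Fin.snoc_castSucc (α := fun _ => ℕ) x d (Fin.castLE hnm i)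
    · rintro ⟨d, hd, hs⟩
      refine ⟨fun i => d i.castSucc, fun i => hd i, d (Fin.last m), ?_⟩
      have : Fin.snoc (α := fun _ => ℕ) (fun i => d i.castSucc) (d (Fin.last m)) = d :=
        Fin.snoc_init_self d
      rw [this]
      exact hs

/-- Every neighbourhood of `X` in the fragment topology contains one given by a single formula of
the fragment, evaluated at any sufficiently long initial segment of `ℕ`. -/
theorem exists_sat_nhd {A : Set (Mod L)} (hA : @IsOpen _ (fragmentTopology F) A) {X : Mod L}
    (hX : X ∈ A) :
    ∃ m₀, ∀ m ≥ m₀, ∃ ψ ∈ F.mem m, Sat X ψ (fun i : Fin m => (i : ℕ)) ∧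
      ∀ Y : Mod L, Sat Y ψ (fun i : Fin m => (i : ℕ)) → Y ∈ A := by
  have hA' : TopologicalSpace.GenerateOpen _ A := hA
  induction hA' with
  | basic s hs =>
    obtain ⟨n, φ, a, hφ, rfl⟩ := hs
    refine ⟨Finset.univ.sup a + 1, fun m hm => ?_⟩
    have ha : ∀ i, a i < m := fun i =>
      lt_of_lt_of_le (Nat.lt_succ_of_le (Finset.le_sup (f := a) (Finset.mem_univ i))) hm
    -- Under the assignment of `j` to the variable `x_j`, the parameter `a i` is named by the
    -- variable with index `a i`.
    have key : ∀ Y : Mod L, Sat Y (φ.subst fun i => .var ⟨a i, ha i⟩) (fun i : Fin m => (i : ℕ)) ↔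
        Sat Y φ a := fun Y => @Fml.realize_subst L ℕ Y _ φ _ _ _
    exact ⟨_, F.subst_mem φ _ hφ, (key X).2 hX, fun Y hY => (key Y).1 hY⟩
  | univ => exact ⟨0, fun m _ => ⟨.verum, F.verum_mem m, trivial, fun _ _ => trivial⟩⟩
  | inter s t hs ht ihs iht =>
    obtain ⟨m₁, h₁⟩ := ihs hs hX.1
    obtain ⟨m₂, h₂⟩ := iht ht hX.2
    refine ⟨max m₁ m₂, fun m hm => ?_⟩
    obtain ⟨ψ, hψ, hXψ, hψs⟩ := h₁ m (le_trans (le_max_left _ _) hm)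
    obtain ⟨χ, hχ, hXχ, hχt⟩ := h₂ m (le_trans (le_max_right _ _) hm)
    exact ⟨.and ψ χ, (F.and_mem_iff _ _).2 ⟨hψ, hχ⟩, ⟨hXψ, hXχ⟩,
      fun Y hY => ⟨hψs Y hY.1, hχt Y hY.2⟩⟩
  | sUnion S hS ih =>
    obtain ⟨s, hs, hXs⟩ := hX
    obtain ⟨m₀, h⟩ := ih s hs (hS s hs) hXs
    refine ⟨m₀, fun m hm => ?_⟩
    obtain ⟨ψ, hψ, hXψ, hψs⟩ := h m hm
    exact ⟨ψ, hψ, hXψ, fun Y hY => ⟨s, hs, hψs Y hY⟩⟩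

end Fragment

/-! Generic permutations -/

/-- The list `g 0, …, g (n - 1)`. -/
def initSeg (g : ℕ → ℕ) (n : ℕ) : List ℕ := (List.range n).map g

@[simp]
theorem length_initSeg (g : ℕ → ℕ) (n : ℕ) : (initSeg g n).length = n := by simp [initSeg]

@[simp]
theorem getElem_initSeg (g : ℕ → ℕ) (n i : ℕ) (hi : i < (initSeg g n).length) :
    (initSeg g n)[i] = g i := by simp [initSeg]

theorem initSeg_prefix (g : ℕ → ℕ) {m n : ℕ} (h : m ≤ n) : initSeg g m <+: initSeg g n := by
  rw [List.prefix_iff_eq_take]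
  apply List.ext_getElem <;> simp [h]

theorem nodup_initSeg (g : Equiv.Perm ℕ) (n : ℕ) : (initSeg g n).Nodup :=
  List.nodup_range.map g.injective

/-- The list `b` is an initial segment of `g`. -/
def Extends (g : ℕ → ℕ) (b : List ℕ) : Prop := initSeg g b.length = b

theorem Extends.of_prefix {g : ℕ → ℕ} {b c : List ℕ} (h : Extends g c) (hbc : b <+: c) :
    Extends g b := by
  have h1 : initSeg g b.length <+: c := by
    have := initSeg_prefix g hbc.length_le
    rwa [h] at this
  exact (List.prefix_of_prefix_length_le h1 hbc (by simp)).eq_of_length (by simp)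

theorem extends_initSeg (g : ℕ → ℕ) (n : ℕ) : Extends g (initSeg g n) := by
  simp [Extends]

theorem Extends.prefix_initSeg {g : ℕ → ℕ} {b : List ℕ} (h : Extends g b) {n : ℕ}
    (hn : b.length ≤ n) : b <+: initSeg g n := by
  have := initSeg_prefix g hn
  rwa [h] at this

theorem Extends.nodup {g : Equiv.Perm ℕ} {b : List ℕ} (h : Extends g b) : b.Nodup := by
  have := nodup_initSeg g b.length
  rwa [h] at this

/-- Density among the finite injective sequences, ordered by extension. -/
def DenseLists (D : Set (List ℕ)) : Prop :=
  ∀ b : List ℕ, b.Nodup → ∃ c ∈ D, b <+: c ∧ c.Nodup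

/-- The permutation `g` meets all the sets in `𝒟`. -/
def GenericFor (𝒟 : Set (Set (List ℕ))) (g : Equiv.Perm ℕ) : Prop :=
  ∀ D ∈ 𝒟, ∃ n, initSeg g n ∈ D

theorem denseLists_mem (m : ℕ) : DenseLists {c | m ∈ c} := by
  intro b hb
  by_cases hm : m ∈ b
  · exact ⟨b, hm, List.prefix_rfl, hb⟩
  · refine ⟨b ++ [m], by simp, List.prefix_append _ _, ?_⟩
    rw [List.nodup_append_comm]
    simpa using ⟨hm, hb⟩

theorem denseLists_lt_length (n : ℕ) : DenseLists {c | n < c.length} := by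
  have key : ∀ n, DenseLists {c | n ≤ c.length} := by
    intro n
    induction n with
    | zero => exact fun b hb => ⟨b, Nat.zero_le _, List.prefix_rfl, hb⟩
    | succ n ih =>
      intro b hb
      obtain ⟨c, hc, hbc, hcn⟩ := ih b hb
      obtain ⟨m, hm⟩ := Infinite.exists_notMem_finset c.toFinset
      refine ⟨c ++ [m], by simpa using hc, hbc.trans (List.prefix_append _ _), ?_⟩
      rw [List.nodup_append_comm]
      simpa using ⟨by simpa using hm, hcn⟩
  exact key (n + 1)

/-- The Rasiowa–Sikorski lemma for finite injective sequences. -/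
theorem exists_genericFor {𝒟 : Set (Set (List ℕ))} (hc : 𝒟.Countable)
    (hd : ∀ D ∈ 𝒟, DenseLists D) {b : List ℕ} (hb : b.Nodup) :
    ∃ g : Equiv.Perm ℕ, Extends g b ∧ GenericFor 𝒟 g := by
  -- The added dense sets make the limit of the chain surjective and everywhere defined; injectivity
  -- comes from the chain itself.
  set ℰ : Set (Set (List ℕ)) := 𝒟 ∪ Set.range (fun m : ℕ => {c : List ℕ | m ∈ c}) ∪
    Set.range (fun n : ℕ => {c : List ℕ | n < c.length}) with hℰ
  have hEc : ℰ.Countable := (hc.union (Set.countable_range _)).union (Set.countable_range _)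
  have hEd : ∀ D ∈ ℰ, DenseLists D := by
    rintro D ((h | ⟨m, rfl⟩) | ⟨n, rfl⟩)
    · exact hd D h
    · exact denseLists_mem m
    · exact denseLists_lt_length n
  have hEn : ℰ.Nonempty := ⟨_, Or.inr ⟨0, rfl⟩⟩
  obtain ⟨D, hD⟩ := hEc.exists_eq_range hEn
  have hDd : ∀ k, DenseLists (D k) := fun k => hEd _ (hD ▸ ⟨k, rfl⟩)
  choose! f hfD hfp hfn using hDd
  let s : ℕ → List ℕ := fun k => Nat.rec b (fun k c => f k c) k
  have hsn : ∀ k, (s k).Nodup := by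
    intro k
    induction k with
    | zero => exact hb
    | succ k ih => exact hfn k (s k) ih
  have hsD : ∀ k, s (k + 1) ∈ D k := fun k => hfD k (s k) (hsn k)
  have hsp : ∀ {j k}, j ≤ k → s j <+: s k := by
    intro j k hjk
    induction k, hjk using Nat.le_induction with
    | base => exact List.prefix_rfl
    | succ k _ ih => exact ih.trans (hfp k (s k) (hsn k))
  have hmeet : ∀ E ∈ ℰ, ∃ k, s k ∈ E := by
    intro E hE
    rw [hD] at hE
    obtain ⟨k, rfl⟩ := hE
    exact ⟨k + 1, hsD k⟩
  have hlen : ∀ n, ∃ k, n < (s k).length := fun n => hmeet _ (Or.inr ⟨n, rfl⟩)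
  choose K hK using hlen
  let g : ℕ → ℕ := fun n => (s (K n))[n]'(hK n)
  have hg : ∀ k, Extends g (s k) := by
    intro k
    refine List.ext_getElem (by simp) fun i h1 h2 => ?_
    rw [getElem_initSeg]
    rcases le_total k (K i) with h | h
    · exact ((hsp h).getElem h2).symm
    · exact (hsp h).getElem (hK i)
  have hgi : ∀ k i (hi : i < (s k).length), g i = (s k)[i] := by
    intro k i hi
    have h := hg k
    have h2 : (initSeg g (s k).length)[i]'(by simpa using hi) = (s k)[i] :=
      List.getElem_of_eq h _
    rwa [getElem_initSeg] at h2
  have hinj : Function.Injective g := by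
    intro i j hij
    have hi := lt_of_lt_of_le (hK i) (hsp (le_max_left (K i) (K j))).length_le
    have hj := lt_of_lt_of_le (hK j) (hsp (le_max_right (K i) (K j))).length_le
    rw [hgi _ i hi, hgi _ j hj] at hij
    exact ((hsn _).getElem_inj_iff).1 hij
  have hsurj : Function.Surjective g := by
    intro m
    obtain ⟨k, hk⟩ := hmeet _ (Or.inl (Or.inr ⟨m, rfl⟩))
    obtain ⟨i, hi, rfl⟩ := List.getElem_of_mem hk
    exact ⟨i, hgi k i hi⟩
  refine ⟨Equiv.ofBijective g ⟨hinj, hsurj⟩, hg 0, fun E hE => ?_⟩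
  obtain ⟨k, hk⟩ := hmeet E (Or.inl (Or.inl hE))
  refine ⟨(s k).length, ?_⟩
  have : initSeg g (s k).length = s k := hg k
  rw [← this] at hk
  exact hk

/-! Pullbacks of structures -/

/-- The structure on `ℕ` that makes `g` an isomorphism onto `N`. -/
@[reducible]
def pullback (g : Equiv.Perm ℕ) (N : Mod L) : Mod L :=
  @Equiv.inducedStructure L ℕ ℕ N g.symm

/-- The permutation `g`, as an isomorphism of `pullback g N` onto `N`. -/
def pullbackEquiv (g : Equiv.Perm ℕ) (N : Mod L) :
    @FirstOrder.Language.Equiv L ℕ ℕ (pullback g N) N :=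
  @FirstOrder.Language.Equiv.mk L ℕ ℕ (pullback g N) N g
    (fun _ _ => g.apply_symm_apply _) (fun _ _ => Iff.rfl)

/-- An isomorphism of structures on `ℕ` is a permutation that preserves satisfaction. -/
theorem exists_perm_sat {M N : Mod L} (e : @FirstOrder.Language.Equiv L ℕ ℕ M N) :
    ∃ g : Equiv.Perm ℕ, ∀ {n : ℕ} (φ : Fml L n) (a : Fin n → ℕ), Sat N φ (g ∘ a) ↔ Sat M φ a :=
  ⟨@FirstOrder.Language.Equiv.toEquiv L ℕ ℕ M N e,
    fun φ a => @Fml.realize_comp_equiv L ℕ ℕ M N e _ φ a⟩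

theorem sat_pullback (g : Equiv.Perm ℕ) (N : Mod L) {n : ℕ} (φ : Fml L n) (a : Fin n → ℕ) :
    Sat (pullback g N) φ a ↔ Sat N φ (g ∘ a) :=
  (@Fml.realize_comp_equiv L ℕ ℕ (pullback g N) N (pullbackEquiv g N) n φ a).symm

/-! Iterated types -/

variable (F : Fragment L)

theorem iterTp_zero (M : Mod L) (a : List ℕ) : iterTp F M 0 a = HSet.atom (tp F M a) := by
  rw [iterTp, if_pos rfl]

theorem iterTp_of_ne_zero (M : Mod L) {α : Ordinal.{0}} (hα : α ≠ 0) (a : List ℕ) :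
    iterTp F M α a =
      HSet.range (fun p : Set.Iio α × {b : List ℕ // a <+: b} => iterTp F M p.1 p.2) := by
  rw [iterTp, if_neg hα]

variable {F}

/-- An iterated type determines the iterated types of smaller rank of all extensions. The ranks
may a priori differ. -/
theorem exists_iterTp_eq {M N : Mod L} {α β : Ordinal.{0}} {a b : List ℕ}
    (h : iterTp F M α a = iterTp F N β b) {γ : Ordinal.{0}} (hγ : γ < α) {c : List ℕ}
    (hc : a <+: c) : ∃ δ < β, ∃ d, b <+: d ∧ iterTp F M γ c = iterTp F N δ d := by
  have hα : α ≠ 0 := (lt_of_le_of_lt (zero_le (a := γ)) hγ).ne'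
  rw [iterTp_of_ne_zero F M hα] at h
  by_cases hβ : β = 0
  · rw [hβ, iterTp_zero] at h
    exact (HSet.atom_ne_range _ _ h.symm).elim
  · rw [iterTp_of_ne_zero F N hβ, HSet.range_eq_range_iff] at h
    obtain ⟨p, hp⟩ := h.subset ⟨(⟨γ, hγ⟩, ⟨c, hc⟩), rfl⟩
    exact ⟨p.1, p.1.2, p.2, p.2.2, hp.symm⟩

/-- If β < α, the rank-α type has the rank-β type of `a` as a member, so this equals a type of some
rank δ < β, against the induction hypothesis. Members of equal types can therefore be matched with
the same rank. -/
theorem rank_le_of_iterTp_eq {M N : Mod L} {α β : Ordinal.{0}} {a b : List ℕ}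
    (h : iterTp F M α a = iterTp F N β b) : α ≤ β := by
  induction α using WellFoundedLT.induction generalizing M N β a b with
  | ind α ih =>
    by_contra hlt
    obtain ⟨δ, hδ, d, _, hd⟩ := exists_iterTp_eq h (not_le.1 hlt) List.prefix_rfl
    exact absurd (ih β (not_le.1 hlt) hd) (not_le.2 hδ)

theorem exists_iterTp_eq_of_lt {M N : Mod L} {α : Ordinal.{0}} {a b : List ℕ}
    (h : iterTp F M α a = iterTp F N α b) {γ : Ordinal.{0}} (hγ : γ < α) {c : List ℕ}
    (hc : a <+: c) : ∃ d, b <+: d ∧ iterTp F M γ c = iterTp F N γ d := by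
  obtain ⟨δ, _, d, hbd, hd⟩ := exists_iterTp_eq h hγ hc
  obtain rfl : γ = δ := le_antisymm (rank_le_of_iterTp_eq hd) (rank_le_of_iterTp_eq hd.symm)
  exact ⟨d, hbd, hd⟩

theorem tp_eq_of_iterTp_eq {M N : Mod L} {α : Ordinal.{0}} {a b : List ℕ}
    (h : iterTp F M α a = iterTp F N α b) : tp F M a = tp F N b := by
  rcases eq_or_ne α 0 with rfl | hα
  · rwa [iterTp_zero, iterTp_zero, HSet.atom_inj] at h
  · have key : ∀ {M N : Mod L} {a b : List ℕ}, iterTp F M α a = iterTp F N α b →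
        ∃ d, b <+: d ∧ tp F M a = tp F N d := by
      intro M N a b h
      obtain ⟨d, hbd, hd⟩ := exists_iterTp_eq_of_lt h (pos_iff_ne_zero.2 hα)
        (List.prefix_rfl (l := a))
      exact ⟨d, hbd, by rwa [iterTp_zero, iterTp_zero, HSet.atom_inj] at hd⟩
    -- The type of `a` is matched only by that of some extension `d` of `b`; the symmetric match
    -- bounds lengths and forces `d = b`.
    obtain ⟨d, hbd, hd⟩ := key h
    obtain ⟨c, hac, hc⟩ := key h.symm
    have h1 : a.length = d.length := congrArg Sigma.fst hd
    have h2 : b.length = c.length := congrArg Sigma.fst hc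
    have : b = d := hbd.eq_of_length (le_antisymm hbd.length_le
      (by rw [← h1, h2]; exact hac.length_le))
    rw [hd, this]

theorem sat_iff_of_tp_eq {M N : Mod L} {a b : List ℕ} (h : tp F M a = tp F N b) {n : ℕ}
    (ha : n = a.length) (hb : n = b.length) {φ : Fml L n} (hφ : φ ∈ F.mem n) :
    Sat M φ (fun i => a.get (i.cast ha)) ↔ Sat N φ (fun i => b.get (i.cast hb)) := by
  subst ha
  -- The length is generalized to `k` so that the dependent equality of types can be unpacked.
  have h' : ∀ (k : ℕ) (hk : a.length = k) (S : Set (Fml L k)),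
      tp F M a = ⟨k, S⟩ → (φ ∈ F.mem a.length ∧ Sat M φ a.get ↔ hk ▸ φ ∈ S) := by
    rintro _ rfl S hS
    have := eq_of_heq (Sigma.mk.inj hS).2
    rw [← this]
    rfl
  have h1 := h' _ hb _ h
  have h2 : ∀ (k : ℕ) (hk : a.length = k) (d : Fin k → ℕ),
      (hk ▸ φ ∈ {φ : Fml L k | φ ∈ F.mem k ∧ Sat N φ d}) ↔
        (φ ∈ F.mem a.length ∧ Sat N φ (fun i => d (i.cast hk))) := by
    rintro _ rfl d
    rfl
  rw [h2] at h1
  exact ⟨fun h => (h1.1 ⟨hφ, h⟩).2, fun h => (h1.2 ⟨hφ, h⟩).2⟩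

theorem length_eq_of_tp_eq {M N : Mod L} {a b : List ℕ} (h : tp F M a = tp F N b) :
    a.length = b.length :=
  congrArg Sigma.fst h

theorem nodup_of_tp_eq {M N : Mod L} {a b : List ℕ} (h : tp F M a = tp F N b) (ha : a.Nodup) :
    b.Nodup := by
  obtain ⟨ψ, hψ, hinj⟩ := F.exists_sat_iff_injective a.length
  have h1 := sat_iff_of_tp_eq h rfl (length_eq_of_tp_eq h) hψ
  rw [hinj, hinj] at h1
  have h2 := h1.1 (List.nodup_iff_injective_get.1 ha)
  rw [List.nodup_iff_injective_get]
  intro i j hij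
  have := @h2 (i.cast (length_eq_of_tp_eq h).symm) (j.cast (length_eq_of_tp_eq h).symm)
    (by simpa using hij)
  simpa using this

theorem iterTp_map_perm {M N : Mod L} {g : Equiv.Perm ℕ}
    (hg : ∀ {n : ℕ} (φ : Fml L n) (a : Fin n → ℕ), Sat N φ (g ∘ a) ↔ Sat M φ a) (α : Ordinal.{0}) (a : List ℕ) :
    iterTp F M α a = iterTp F N α (a.map g) := by
  induction α using WellFoundedLT.induction generalizing a with
  | ind α ih =>
    rcases eq_or_ne α 0 with rfl | hα
    · rw [iterTp_zero, iterTp_zero, HSet.atom_inj]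
      have key : ∀ (k : ℕ) (hk : a.length = k) (d : Fin k → ℕ)
          (_ : ∀ i, d i = g (a.get (i.cast hk.symm))),
          tp F M a = ⟨k, {φ | φ ∈ F.mem k ∧ Sat N φ d}⟩ := by
        rintro _ rfl d hd
        refine congrArg (Sigma.mk a.length) (Set.ext fun φ => and_congr_right fun _ => ?_)
        obtain rfl : d = g ∘ a.get := funext hd
        exact (hg φ a.get).symm
      exact key _ (by simp) _ (by simp)
    · rw [iterTp_of_ne_zero F M hα, iterTp_of_ne_zero F N hα, HSet.range_eq_range_iff]
      ext x
      constructor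
      · rintro ⟨p, rfl⟩
        exact ⟨(p.1, ⟨p.2.1.map g, p.2.2.map _⟩), (ih p.1 p.1.2 _).symm⟩
      · rintro ⟨p, rfl⟩
        have hm : (p.2.1.map g.symm).map g = p.2.1 := by simp
        refine ⟨(p.1, ⟨p.2.1.map g.symm, ?_⟩), ?_⟩
        · have := p.2.2.map g.symm
          simpa using this
        · refine (ih p.1 p.1.2 _).trans ?_
          simp only [hm]

/-! Vaught transforms -/

/-- A set `A` of structures has a Vaught transform of rank `α`: a relation `P N b`, determined by
the iterated type of `b` in `N` of rank `α`, which says that the pullback of `N` along a generic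
permutation extending `b` may be in `A`. -/
def HasTransform (F : Fragment L) (α : Ordinal.{0}) (A : Set (Mod L)) : Prop :=
  ∃ P : Mod L → List ℕ → Prop,
    (∀ N b c, b <+: c → P N c → P N b) ∧
    (∀ N N' b b', iterTp F N α b = iterTp F N' α b' → P N b → P N' b') ∧
    (∀ N b, P N b → ∃ g : Equiv.Perm ℕ, Extends g b ∧ pullback g N ∈ A) ∧
    ∀ N, ∃ 𝒟 : Set (Set (List ℕ)), 𝒟.Countable ∧ (∀ D ∈ 𝒟, DenseLists D) ∧
      ∀ g, GenericFor 𝒟 g → (pullback g N ∈ A ↔ ∀ n, P N (initSeg g n))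

theorem sat_pullback_val (g : Equiv.Perm ℕ) (N : Mod L) {m : ℕ} (ψ : Fml L m) :
    Sat (pullback g N) ψ (fun i : Fin m => (i : ℕ)) ↔ Sat N ψ (fun i : Fin m => g i) :=
  sat_pullback g N ψ _

theorem Extends.apply_eq {g : ℕ → ℕ} {b : List ℕ} (h : Extends g b) (i : ℕ) (hi : i < b.length) :
    g i = b[i] := by
  have h2 : (initSeg g b.length)[i]'(by simpa using hi) = b[i] := List.getElem_of_eq h _
  rwa [getElem_initSeg] at h2

theorem hasTransform_of_isOpen {A : Set (Mod L)} (hA : @IsOpen _ (fragmentTopology F) A) :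
    HasTransform F 0 A := by
  refine ⟨fun N b => ∃ g : Equiv.Perm ℕ, Extends g b ∧ pullback g N ∈ A, ?_, ?_,
    fun _ _ h => h, ?_⟩
  · rintro N b c hbc ⟨g, hg, hgA⟩
    exact ⟨g, hg.of_prefix hbc, hgA⟩
  · rintro N N' b b' h ⟨g, hg, hgA⟩
    have htp := tp_eq_of_iterTp_eq h
    have hlen := length_eq_of_tp_eq htp
    obtain ⟨m₀, hm₀⟩ := F.exists_sat_nhd hA hgA
    obtain ⟨ψ, hψ, hgψ, hψA⟩ := hm₀ (max m₀ b.length) (le_max_left _ _)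
    -- Injectivity is added to the formula so that the tuple found in `N'` extends to a permutation.
    obtain ⟨ι, hι, hιi⟩ := F.exists_sat_iff_injective (max m₀ b.length)
    obtain ⟨χ, hχ, hχi⟩ := F.exists_sat_iff_exists (le_max_right m₀ b.length) (.and ψ ι)
      ((F.and_mem_iff _ _).2 ⟨hψ, hι⟩)
    rw [sat_pullback_val] at hgψ
    have h1 : Sat N χ (fun i => b.get (i.cast rfl)) := by
      refine (hχi N _).2 ⟨fun i => g i, fun i => hg.apply_eq i i.2, hgψ, ?_⟩
      exact (hιi N _).2 fun i j hij => Fin.ext (g.injective hij)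
    rw [sat_iff_of_tp_eq htp rfl hlen hχ] at h1
    obtain ⟨d, hdb, hdψ, hdi⟩ := (hχi N' _).1 h1
    have hdi := (hιi N' d).1 hdi
    obtain ⟨g', hg', -⟩ := exists_genericFor (𝒟 := ∅) Set.countable_empty (by simp)
      (List.nodup_ofFn.2 hdi)
    have hgd : ∀ i : Fin (max m₀ b.length), g' i = d i := fun i => by
      rw [hg'.apply_eq i (by simpa using i.2), List.getElem_ofFn]
    refine ⟨g', ?_, hψA _ ?_⟩
    · refine List.ext_getElem (by simp) fun i hi hi' => ?_
      have hib : i < b.length := hlen ▸ hi'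
      have h3 := hdb ⟨i, hib⟩
      have h4 := hgd (Fin.castLE (le_max_right m₀ b.length) ⟨i, hib⟩)
      rw [getElem_initSeg]
      exact h4.trans h3
    · rw [sat_pullback_val]
      have : (fun i : Fin (max m₀ b.length) => g' i) = d := funext hgd
      rwa [this]
  · intro N
    -- One dense set suffices: the sequences that decide membership in `A`. Openness gives density,
    -- since a finite part of `g` already secures membership.
    refine ⟨{{b | (¬ ∃ g : Equiv.Perm ℕ, Extends g b ∧ pullback g N ∈ A) ∨
      ∀ g : Equiv.Perm ℕ, Extends g b → pullback g N ∈ A}}, Set.countable_singleton _, ?_, ?_⟩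
    · rintro _ rfl b hb
      by_cases hP : ∃ g : Equiv.Perm ℕ, Extends g b ∧ pullback g N ∈ A
      · obtain ⟨g, hg, hgA⟩ := hP
        obtain ⟨m₀, hm₀⟩ := F.exists_sat_nhd hA hgA
        obtain ⟨ψ, hψ, hgψ, hψA⟩ := hm₀ (max m₀ b.length) (le_max_left _ _)
        refine ⟨initSeg g (max m₀ b.length), Or.inr fun g' hg' => hψA _ ?_,
          hg.prefix_initSeg (le_max_right _ _), nodup_initSeg g _⟩
        rw [sat_pullback_val] at hgψ ⊢
        have : (fun i : Fin (max m₀ b.length) => g' i) =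
            fun i : Fin (max m₀ b.length) => g i := by
          funext i
          rw [hg'.apply_eq i (by simpa using i.2), getElem_initSeg]
        rwa [this]
      · exact ⟨b, Or.inl hP, List.prefix_rfl, hb⟩
    · intro g hg
      refine ⟨fun h n => ⟨g, extends_initSeg g n, h⟩, fun h => ?_⟩
      obtain ⟨n, hn | hn⟩ := hg _ rfl
      · exact absurd (h n) hn
      · exact hn g (extends_initSeg g n)

theorem hasTransform_iUnion_compl {α : Ordinal.{0}} {β : ℕ → Ordinal.{0}} (hβ : ∀ n, β n < α)
    {A : ℕ → Set (Mod L)} (hA : ∀ n, HasTransform F (β n) (A n)) :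
    HasTransform F α (⋃ n, (A n)ᶜ) := by
  choose P hmono hinv hreal 𝒟 hc hd hgen using hA
  refine ⟨fun N b => ∃ n c, b <+: c ∧ c.Nodup ∧ ¬ P n N c, ?_, ?_, ?_, ?_⟩
  · rintro N b c hbc ⟨n, d, hcd, hd, hP⟩
    exact ⟨n, d, hbc.trans hcd, hd, hP⟩
  · rintro N N' b b' h ⟨n, c, hbc, hcn, hP⟩
    obtain ⟨c', hbc', hcc'⟩ := exists_iterTp_eq_of_lt h (hβ n) hbc
    exact ⟨n, c', hbc', nodup_of_tp_eq (tp_eq_of_iterTp_eq hcc') hcn,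
      fun hP' => hP (hinv n _ _ _ _ hcc'.symm hP')⟩
  · rintro N b ⟨n, c, hbc, hcn, hP⟩
    -- A permutation generic for `A n` and extending `c` has its pullback outside `A n`, because `P
    -- n` fails at its initial segment `c`.
    obtain ⟨g, hgc, hg⟩ := exists_genericFor (hc n N) (hd n N) hcn
    refine ⟨g, hgc.of_prefix hbc, Set.mem_iUnion.2 ⟨n, fun hgA => hP ?_⟩⟩
    have := (hgen n N g hg).1 hgA c.length
    rwa [hgc] at this
  · intro N
    -- Besides genericity for each `A n`, the permutation must reach a failure of some `P n`
    -- whenever failures remain possible below it.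
    refine ⟨insert {b | (¬ ∃ n c, b <+: c ∧ c.Nodup ∧ ¬ P n N c) ∨ ∃ n, ¬ P n N b}
      (⋃ n, 𝒟 n N), (Set.countable_iUnion fun n => hc n N).insert _, ?_, ?_⟩
    · rintro D (rfl | hD)
      · intro b hb
        by_cases h : ∃ n c, b <+: c ∧ c.Nodup ∧ ¬ P n N c
        · obtain ⟨n, c, hbc, hcn, hP⟩ := h
          exact ⟨c, Or.inr ⟨n, hP⟩, hbc, hcn⟩
        · exact ⟨b, Or.inl h, List.prefix_rfl, hb⟩
      · obtain ⟨n, hn⟩ := Set.mem_iUnion.1 hD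
        exact hd n N D hn
    · intro g hg
      have hg' : ∀ n, pullback g N ∈ A n ↔ ∀ k, P n N (initSeg g k) := fun n =>
        hgen n N g fun D hD => hg D (Or.inr (Set.mem_iUnion.2 ⟨n, hD⟩))
      have hmem : pullback g N ∈ (⋃ n, (A n)ᶜ) ↔ ∃ n k, ¬ P n N (initSeg g k) := by
        simp [hg']
      rw [hmem]
      constructor
      · rintro ⟨n, k, hP⟩ m
        exact ⟨n, initSeg g (max k m), initSeg_prefix g (le_max_right _ _), nodup_initSeg g _,
          fun h => hP (hmono n _ _ _ (initSeg_prefix g (le_max_left _ _)) h)⟩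
      · intro h
        obtain ⟨k, hk | ⟨n, hn⟩⟩ := hg _ (Or.inl rfl)
        · exact absurd (h k) hk
        · exact ⟨n, k, hn⟩

/-! ### Transforms along the Borel hierarchy, and the theorem -/

theorem SigmaZero.one_le {X : Type w} {t : TopologicalSpace X} {ξ : Ordinal.{0}} {A : Set X}
    (h : SigmaZero t ξ A) : 1 ≤ ξ := by
  cases h with
  | of_isOpen => exact le_rfl
  | iUnion_compl _ hξ => exact hξ.le

theorem SigmaZero.hasTransform {ξ : Ordinal.{0}} {A : Set (Mod L)}
    (h : SigmaZero (fragmentTopology F) ξ A) : ∀ {α : Ordinal.{0}}, ξ = 1 + α →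
      HasTransform F α A := by
  induction h with
  | of_isOpen U hU =>
    intro α hα
    obtain rfl : α = 0 := by
      refine (add_left_cancel (a := (1 : Ordinal.{0})) ?_).symm
      rw [add_zero]
      exact hα
    exact hasTransform_of_isOpen hU
  | iUnion_compl ξ hξ η hη A hA ih =>
    rintro α rfl
    -- Classes start at 1 and type ranks at 0, so the rank is recovered by left subtraction of 1,
    -- which leaves infinite ordinals unchanged.
    have h1 : ∀ n, 1 + (η n - 1) = η n := fun n =>
      Ordinal.add_sub_cancel_of_le (hA n).one_le
    refine hasTransform_iUnion_compl (β := fun n => η n - 1) (fun n => ?_)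
      fun n => ih n (h1 n).symm
    have := hη n
    rw [← h1 n] at this
    exact (add_lt_add_iff_left 1).1 this

end InfLogic

theorem mainTheorem9 (L : FirstOrder.Language.{u, v}) [Countable L.Symbols]
    (F : InfLogic.Fragment L) (α : Ordinal.{0}) (hα : 1 ≤ α) (hα' : α < Ordinal.omega 1)
    (M : InfLogic.Mod L)
    (hM : InfLogic.PiZero (InfLogic.fragmentTopology F) (1 + α) (InfLogic.isoClass M)) :
    InfLogic.isoClass M =
      {N : InfLogic.Mod L | InfLogic.iterTh F α N = InfLogic.iterTh F α M} := by
  ext N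
  constructor
  · rintro ⟨e⟩
    obtain ⟨g, hg⟩ := InfLogic.exists_perm_sat e
    exact (InfLogic.iterTp_map_perm hg α []).symm
  · intro hN
    by_contra hne
    obtain ⟨P, -, hinv, hreal, hgen⟩ := InfLogic.SigmaZero.hasTransform hM rfl
    obtain ⟨𝒟, hc, hd, hg⟩ := hgen N
    obtain ⟨g, -, hgg⟩ := InfLogic.exists_genericFor hc hd List.nodup_nil
    have hgN : InfLogic.pullback g N ∉ InfLogic.isoClass M := by
      rintro ⟨e⟩
      exact hne ⟨@FirstOrder.Language.Equiv.comp L ℕ ℕ M (InfLogic.pullback g N) ℕ N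
        (InfLogic.pullbackEquiv g N) e⟩
    have hPM : P M [] := hinv N M [] [] hN ((hg g hgg).1 hgN 0)
    obtain ⟨g', -, hg'⟩ := hreal M [] hPM
    exact hg' ⟨@FirstOrder.Language.Equiv.symm L ℕ ℕ (InfLogic.pullback g' M) M
      (InfLogic.pullbackEquiv g' M)⟩
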